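/- Theorem 1.2. Let $\alpha>0$. For $g\in L^1[-\pi,\pi]$ let $u_g$ denote the unique function $u\in C^1[-\pi,\pi]$ such that $u'$ is absolutely continuous on $[-\pi,\pi]$, $-u''=g$ almost everywhere on $(-\pi,\pi)$, and $$-u'(-\pi)+\alpha u(-\pi)=u'(\pi)+\alpha u(\pi)=0.$$ For $f\in L^1[-\pi,\pi]$ let $f^\#(x)=f^*(2|x|)$, $x\in[-\pi,\pi]$, be its symmetric decreasing rearrangement, where $f^*(0)=\operatorname{ess\,sup}f$, $f^*(2\pi)=\operatorname{ess\,inf}f$, and $$f^*(t)=\inf\{s\in\mathbb R:\lambda(\{x\in[-\pi,\pi]:f(x)>s\})\le t\}\qquad(0<t<2\pi),$$ with $\lambda$ the Lebesgue measure. Let $0\le f\in L^1[-\pi,\pi]$. Then, for every convex and increasing (i.e. nondecreasing) function $\phi:\mathbb R\to\mathbb R$, $$\int_{-\pi}^{\pi}\phi\bigl(u_f(x)\bigr)\,dx\le\int_{-\pi}^{\pi}\phi\bigl(u_{f^\#}(x)\bigr)\,dx .$$ If $\phi$ is moreover strictly increasing, then equality holds if and only if $f=f^\#$ almost everywhere on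 $[-\pi,\pi]$. In particular, $\|u_f\|_{L^p}\le\|u_{f^\#}\|_{L^p}$ on $[-\pi,\pi]$ for all $1\le p\le+\infty$. -/

import Mathlib

open Real Set MeasureTheory

noncomputable section

/-- The decreasing rearrangement `f^*` of `f` on `X ⊆ ℝ`, as a function of `t ∈ [0, λ(X)]` with
values in the extended reals: `ess sup_X f` at `t = 0`, then
`inf {s ∈ ℝ : λ({x ∈ X : f x > s}) ≤ t}` for `0 < t < λ(X)`, and `ess inf_X f` at `t = λ(X)`.
(Values at `t` outside `[0, λ(X)]` are irrelevant.) -/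
def decreasingRearrangement (X : Set ℝ) (f : ℝ → ℝ) (t : ℝ) : EReal :=
  open Classical in
  if t = 0 then essSup (fun x => (f x : EReal)) (volume.restrict X)
  else if ENNReal.ofReal t < volume X then
    sInf ((fun s : ℝ => (s : EReal)) ''
      {s : ℝ | volume {x : ℝ | x ∈ X ∧ s < f x} ≤ ENNReal.ofReal t})
  else essInf (fun x => (f x : EReal)) (volume.restrict X)

/-- The symmetric decreasing rearrangement `f^#(t) = f^*(2|t|)` of `f` on `X`, for
`t ∈ [-λ(X)/2, λ(X)/2]`. -/
def symmDecreasingRearrangement (X : Set ℝ) (f : ℝ → ℝ) (t : ℝ) : EReal :=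
  decreasingRearrangement X f (2 * |t|)

/-- `u` is a solution on `[-π, π]` of `-u'' = g` with Robin boundary conditions
`-u'(-π) + α u(-π) = u'(π) + α u(π) = 0`: `u ∈ C¹[-π, π]`, `u'` is absolutely continuous on
`[-π, π]`, and at almost every point of `(-π, π)` the second derivative exists and equals `-g`.
The heat source `g` may take infinite values (on a null set, if there is a solution). -/
structure IsRobinSolution (α : ℝ) (g : ℝ → EReal) (u : ℝ → ℝ) : Prop where
  contDiffOn : ContDiffOn ℝ 1 u (Icc (-π) π)
  absolutelyContinuous :
    AbsolutelyContinuousOnInterval (derivWithin u (Icc (-π) π)) (-π) π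
  poisson : ∀ᵐ x ∂(volume.restrict (Ioo (-π) π)),
    ∃ d : ℝ, HasDerivAt (derivWithin u (Icc (-π) π)) d x ∧ ((-d : ℝ) : EReal) = g x
  robin_left : -(derivWithin u (Icc (-π) π) (-π)) + α * u (-π) = 0
  robin_right : derivWithin u (Icc (-π) π) π + α * u π = 0

end

/-! Put `a = π + 1/α`. The Robin conditions say that the tangents to the solution at `±π` vanish at
`±a`, so the Robin Green's function of `[-π, π]` is the restriction of the Dirichlet Green's
function of `[-a, a]`. Averaging the Green's functions with poles `l ≤ r`, with weights proportional
to `a - r` and `a + l`, makes the kernel flat between the poles: this is `trapezoid a l r`. Hence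
the integral of `f` against it is a weighted mean of `u l` and `u r`, and is at least their minimum
(`IsRobinSolution.integral_mul_trapezoid`).

Replacing `f` by `f^#` and centering the trapezoid, with `h = (r - l) / 2`, can only increase that
integral (`integral_mul_trapezoid_le`). By the layer cake formula it suffices to treat indicators of
sets (`setIntegral_trapezoid_le`), a bathtub estimate with an explicit value. Since `v` is even, the
centered integral is `v h`, which gives `min (u x) (u y) ≤ v ((y - x) / 2)` for `x ≤ y`.

Thus if `u > s` at `x` and `y`, then `v > s` on a centered interval of length `y - x`, because `v`
is even and decreasing in `|x|`. So the diameter, and a fortiori the measure, of `{u > s}` is at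
most the measure of `{v > s}` (`volume_superlevel_comp_le`). This comparison of distribution
functions yields all the integral and norm inequalities.

For equality with `φ` strictly increasing, truncating at `max u` shows that `v 0 ≤ max u`. Then
Hardy-Littlewood is an equality for a one-pole kernel, hence at almost every level, and the
superlevel sets of `f` are centered intervals up to null sets. -/

/-! ### Bathtub principle for set integrals -/

/-- If `F` is nonnegative on `S` and nonpositive on `A \ S`, then `∫_A F ≤ ∫_S F`. -/
theorem setIntegral_le_setIntegral_of_sign {F : ℝ → ℝ} {A S : Set ℝ} (hA : MeasurableSet A)
    (hS : MeasurableSet S) (hFA : IntegrableOn F A) (hFS : IntegrableOn F S)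
    (h1 : ∀ x ∈ S, 0 ≤ F x) (h2 : ∀ x ∈ A \ S, F x ≤ 0) :
    ∫ x in A, F x ≤ ∫ x in S, F x := by
  rw [← integral_inter_add_sdiff hS hFA, ← integral_inter_add_sdiff hA hFS, inter_comm S A]
  have e1 : ∫ x in A \ S, F x ≤ 0 := setIntegral_nonpos (hA.diff hS) h2
  have e2 : 0 ≤ ∫ x in S \ A, F x := setIntegral_nonneg (hS.diff hA) fun x hx => h1 x hx.1
  linarith

/-- Equality case of the bathtub principle: any part of `S` of positive measure missed by `A` would
cost a positive amount. -/
theorem volume_diff_eq_zero_of_setIntegral_le {F : ℝ → ℝ} {A S : Set ℝ} (hA : MeasurableSet A)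
    (hS : MeasurableSet S) (hFA : IntegrableOn F A) (hFS : IntegrableOn F S)
    (h1 : ∀ x ∈ S, 0 < F x) (h2 : ∀ x ∈ A \ S, F x ≤ 0)
    (h : ∫ x in S, F x ≤ ∫ x in A, F x) : volume (S \ A) = 0 := by
  rw [← integral_inter_add_sdiff hS hFA, ← integral_inter_add_sdiff hA hFS, inter_comm S A] at h
  have e1 : ∫ x in A \ S, F x ≤ 0 := setIntegral_nonpos (hA.diff hS) h2
  by_contra hne
  have e2 : 0 < ∫ x in S \ A, F x := by
    rw [setIntegral_pos_iff_support_of_nonneg_ae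
      ((ae_restrict_iff' (hS.diff hA)).2 (.of_forall fun x hx => (h1 x hx.1).le))
      (hFS.mono_set sdiff_subset)]
    have : Function.support F ∩ (S \ A) = S \ A :=
      inter_eq_right.2 fun x hx => (h1 x hx.1).ne'
    rw [this]
    exact pos_iff_ne_zero.2 hne
  linarith

/-! ### Trapezoidal kernels integrated over sets of given measure -/

/-- The piecewise linear function on `[-a, a]` that vanishes at `±a`, is constant on `[l, r]`, and
whose slope jumps at `l` and `r` sum up to `-1`: a convex combination of the Dirichlet Green's
functions of `[-a, a]` with poles at `l` and `r`. -/
noncomputable def trapezoid (a l r y : ℝ) : ℝ :=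
  min ((a + l) * (a - r)) (min ((a - r) * (a + y)) ((a + l) * (a - y))) / (2 * a + l - r)

/-- The height of the plateau of `trapezoid a l r`. -/
noncomputable def trapezoidHeight (a l r : ℝ) : ℝ := (a + l) * (a - r) / (2 * a + l - r)

theorem continuous_trapezoid (a l r : ℝ) : Continuous (trapezoid a l r) := by
  unfold trapezoid; fun_prop

section trapezoid

variable {a l r : ℝ}

theorem trapezoid_nonneg (hl : -a < l) (hr : r < a) {y : ℝ} (hy : y ∈ Icc (-a) a) :
    0 ≤ trapezoid a l r y := by
  have h1 : 0 < a + l := by linarith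
  have h2 : 0 < a - r := by linarith
  have h3 : 0 ≤ a + y := by linarith [hy.1]
  have h4 : 0 ≤ a - y := by linarith [hy.2]
  exact div_nonneg (le_min (by positivity) (le_min (by positivity) (by positivity))) (by linarith)

theorem trapezoid_le_height (hl : -a < l) (hr : r < a) (y : ℝ) :
    trapezoid a l r y ≤ trapezoidHeight a l r :=
  div_le_div_of_nonneg_right (min_le_left _ _) (by linarith)

theorem trapezoid_eq_left (hl : -a < l) (hlr : l ≤ r) (hr : r < a) {y : ℝ} (hy : y ≤ l) :
    trapezoid a l r y = (a - r) * (a + y) / (2 * a + l - r) := by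
  have h1 : 0 < a + l := by linarith
  have h2 : 0 < a - r := by linarith
  unfold trapezoid
  rw [min_eq_left (a := (a - r) * (a + y)), min_eq_right] <;> nlinarith

theorem trapezoid_eq_right (hl : -a < l) (hlr : l ≤ r) (hr : r < a) {y : ℝ} (hy : r ≤ y) :
    trapezoid a l r y = (a + l) * (a - y) / (2 * a + l - r) := by
  have h1 : 0 < a + l := by linarith
  have h2 : 0 < a - r := by linarith
  unfold trapezoid
  rw [min_eq_right (b := (a + l) * (a - y)), min_eq_right] <;> nlinarith

theorem trapezoid_eq_height (hl : -a < l) (hr : r < a) {y : ℝ} (hy : y ∈ Icc l r) :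
    trapezoid a l r y = trapezoidHeight a l r := by
  have h1 : 0 < a + l := by linarith
  have h2 : 0 < a - r := by linarith
  have h3 := hy.1
  have h4 := hy.2
  unfold trapezoid trapezoidHeight
  rw [min_eq_left]
  exact le_min (by nlinarith) (by nlinarith)

theorem trapezoidHeight_pos (hl : -a < l) (hr : r < a) : 0 < trapezoidHeight a l r := by
  have h1 : 0 < a + l := by linarith
  have h2 : 0 < a - r := by linarith
  have h3 : 0 < 2 * a + l - r := by linarith
  unfold trapezoidHeight; positivity

/-- With `A = a + l` and `B = a - r` this is `A * B / (A + B) ≤ (A + B) / 4`; the right side is the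
height of the centered trapezoid with the same plateau length. -/
theorem trapezoidHeight_le (hl : -a < l) (hr : r < a) :
    trapezoidHeight a l r ≤ (2 * a + l - r) / 4 := by
  have h3 : 0 < 2 * a + l - r := by linarith
  unfold trapezoidHeight
  rw [div_le_div_iff₀ h3 (by norm_num)]
  nlinarith [sq_nonneg (l + r)]

theorem trapezoid_symm_eq {h : ℝ} (ha : h < a) (y : ℝ) :
    trapezoid a (-h) h y = min (a - h) (a - |y|) / 2 := by
  have h0 : 0 < a - h := by linarith
  unfold trapezoid
  rw [← sub_eq_add_neg, ← mul_min_of_nonneg _ _ h0.le, ← mul_min_of_nonneg _ _ h0.le]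
  have : min (a + y) (a - y) = a - |y| := by
    rcases le_total 0 y with hy | hy
    · rw [abs_of_nonneg hy, min_eq_right (by linarith)]
    · rw [abs_of_nonpos hy, min_eq_left (by linarith)]; ring
  rw [this, show 2 * a + -h - h = (a - h) * 2 by ring, mul_div_mul_left _ _ h0.ne']

theorem trapezoid_sub_nonneg_iff (hl : -a < l) (hr : r < a) {τ y : ℝ}
    (hτH : τ ≤ trapezoidHeight a l r) :
    0 ≤ trapezoid a l r y - τ ↔
      y ∈ Icc (-a + τ * (2 * a + l - r) / (a - r)) (a - τ * (2 * a + l - r) / (a + l)) := by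
  have h1 : 0 < a + l := by linarith
  have h2 : 0 < a - r := by linarith
  have h3 : 0 < 2 * a + l - r := by linarith
  unfold trapezoidHeight at hτH
  rw [le_div_iff₀ h3] at hτH
  rw [sub_nonneg, trapezoid, le_div_iff₀ h3, le_min_iff, le_min_iff, mem_Icc, le_sub_comm,
    ← le_sub_iff_add_le', div_le_iff₀ h1, div_le_iff₀ h2]
  constructor
  · rintro ⟨-, h, h'⟩; constructor <;> nlinarith
  · rintro ⟨h, h'⟩; refine ⟨hτH, ?_, ?_⟩ <;> nlinarith

/-- The area above level `τ` is a rectangle over the plateau plus two triangles. For fixed plateau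
length and level, the value depends on the position only through the height, which reduces the
centering problem to one variable. -/
theorem setIntegral_trapezoid_sub (hl : -a < l) (hlr : l ≤ r) (hr : r < a) {τ : ℝ}
    (hτH : τ ≤ trapezoidHeight a l r) :
    ∫ y in Icc (-a + τ * (2 * a + l - r) / (a - r)) (a - τ * (2 * a + l - r) / (a + l)),
      (trapezoid a l r y - τ) = (trapezoidHeight a l r - τ) * (r - l) +
        (2 * a + l - r) * (trapezoidHeight a l r - τ) ^ 2 / (2 * trapezoidHeight a l r) := by
  have h1 : 0 < a + l := by linarith
  have h2 : 0 < a - r := by linarith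
  have h3 : 0 < 2 * a + l - r := by linarith
  set p := -a + τ * (2 * a + l - r) / (a - r) with hp
  set q := a - τ * (2 * a + l - r) / (a + l) with hq
  have hτ' := hτH
  unfold trapezoidHeight at hτ'
  rw [le_div_iff₀ h3] at hτ'
  have hpl : p ≤ l := by
    rw [hp, ← le_sub_iff_add_le', div_le_iff₀ h2]; nlinarith
  have hrq : r ≤ q := by
    rw [hq, le_sub_comm, div_le_iff₀ h1]; nlinarith
  have hI : ∀ x y : ℝ, IntervalIntegrable (fun y => trapezoid a l r y - τ) volume x y :=
    fun x y => ((continuous_trapezoid a l r).sub continuous_const).intervalIntegrable x y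
  rw [integral_Icc_eq_integral_Ioc, ← intervalIntegral.integral_of_le (by linarith),
    ← intervalIntegral.integral_add_adjacent_intervals (hI p l) (hI l q),
    ← intervalIntegral.integral_add_adjacent_intervals (hI l r) (hI r q)]
  have e1 : ∫ y in p..l, (trapezoid a l r y - τ) =
      ∫ y in p..l, ((a - r) / (2 * a + l - r) * y + ((a - r) * a / (2 * a + l - r) - τ)) := by
    refine intervalIntegral.integral_congr fun y hy => ?_
    rw [uIcc_of_le hpl] at hy
    simp only [trapezoid_eq_left hl hlr hr hy.2]
    ring
  have e2 : ∫ y in l..r, (trapezoid a l r y - τ) =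
      ∫ y in l..r, (trapezoidHeight a l r - τ) := by
    refine intervalIntegral.integral_congr fun y hy => ?_
    rw [uIcc_of_le hlr] at hy
    simp only [trapezoid_eq_height hl hr hy]
  have e3 : ∫ y in r..q, (trapezoid a l r y - τ) =
      ∫ y in r..q, (-(a + l) / (2 * a + l - r) * y + ((a + l) * a / (2 * a + l - r) - τ)) := by
    refine intervalIntegral.integral_congr fun y hy => ?_
    rw [uIcc_of_le hrq] at hy
    simp only [trapezoid_eq_right hl hlr hr hy.1]
    ring
  rw [e1, e2, e3]
  have hlin : ∀ c d x y : ℝ, ∫ t in x..y, (c * t + d) = c * (y ^ 2 - x ^ 2) / 2 + d * (y - x) := by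
    intro c d x y
    rw [intervalIntegral.integral_add (Continuous.intervalIntegrable (by fun_prop) _ _)
      (continuous_const.intervalIntegrable _ _), intervalIntegral.integral_const_mul, integral_id,
      intervalIntegral.integral_const, smul_eq_mul]
    ring
  rw [hlin, hlin, intervalIntegral.integral_const, smul_eq_mul, hp, hq]
  unfold trapezoidHeight
  obtain ⟨A, hA⟩ : ∃ A, A = a + l := ⟨_, rfl⟩
  obtain ⟨B, hB⟩ : ∃ B, B = a - r := ⟨_, rfl⟩
  have hD : 2 * a + l - r = A + B := by linarith
  have hl' : l = A - a := by linarith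
  have hr' : r = a - B := by linarith
  rw [← hA] at h1
  rw [← hB] at h2
  rw [hD, ← hA, ← hB, hl', hr']
  have h4 : 0 < A + B := by linarith
  field_simp
  ring

theorem integrableOn_trapezoid_sub (τ : ℝ) {A : Set ℝ} {c d : ℝ}
    (hAc : A ⊆ Icc c d) : IntegrableOn (fun y => trapezoid a l r y - τ) A :=
  (((continuous_trapezoid a l r).sub continuous_const).integrableOn_Icc (a := c) (b := d)).mono_set
    hAc

theorem setIntegral_trapezoid_eq {A : Set ℝ} {c d : ℝ} (hAc : A ⊆ Icc c d) {m : ℝ} (hm : 0 ≤ m)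
    (hv : volume A = ENNReal.ofReal (2 * m)) (τ : ℝ) :
    ∫ y in A, trapezoid a l r y = (∫ y in A, (trapezoid a l r y - τ)) + 2 * m * τ := by
  have := integral_sub (μ := volume.restrict A) (f := trapezoid a l r) (g := fun _ => τ)
    (((continuous_trapezoid a l r).integrableOn_Icc (a := c) (b := d)).mono_set hAc)
    (integrableOn_const (by rw [hv]; exact ENNReal.ofReal_ne_top))
  rw [this, setIntegral_const, Measure.real, hv, ENNReal.toReal_ofReal (by positivity), smul_eq_mul]
  ring

/-- The function `x - 2 * τ + τ ^ 2 / x` has derivative `1 - τ ^ 2 / x ^ 2`, nonnegative for `x ≥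
τ`. Here `x` stands for the height of a trapezoid. -/
theorem sq_sub_div_le {τ x y : ℝ} (hx : 0 < x) (hτ : 0 ≤ τ) (h1 : τ ≤ x) (h2 : x ≤ y) :
    (x - τ) ^ 2 / x ≤ (y - τ) ^ 2 / y := by
  have hy : 0 < y := by linarith
  rw [div_le_div_iff₀ hx hy]
  have : 0 ≤ (y - x) * (x * y - τ ^ 2) :=
    mul_nonneg (by linarith) (by nlinarith)
  nlinarith

theorem sq_sub_div_lt {τ x y : ℝ} (hx : 0 < x) (hτ : 0 ≤ τ) (h1 : τ ≤ x) (h2 : x < y) :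
    (x - τ) ^ 2 / x < (y - τ) ^ 2 / y := by
  have hy : 0 < y := by linarith
  rw [div_lt_div_iff₀ hx hy]
  have : 0 < (y - x) * (x * y - τ ^ 2) :=
    mul_pos (by linarith) (by nlinarith)
  nlinarith

theorem trapezoidHeight_symm {h : ℝ} (ha : h < a) :
    trapezoidHeight a (-h) h = (a - h) / 2 := by
  have h0 : 0 < a - h := by linarith
  unfold trapezoidHeight
  rw [← sub_eq_add_neg, show 2 * a + -h - h = 2 * (a - h) by ring]
  field_simp

/-- On `[-m, m]`, the part of the symmetric trapezoid above the level of its value at `m`. -/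
theorem setIntegral_trapezoid_symm_sub {h m : ℝ} (hh : 0 ≤ h) (ha : h < a) (hm : h ≤ m) :
    ∫ y in Icc (-m) m, (trapezoid a (-h) h y - (a - m) / 2) =
      ((a - h) / 2 - (a - m) / 2) * (2 * h) +
        2 * (a - h) * (((a - h) / 2 - (a - m) / 2) ^ 2 / (2 * ((a - h) / 2))) := by
  have h0 : 0 < a - h := by linarith
  have := setIntegral_trapezoid_sub (a := a) (l := -h) (r := h) (τ := (a - m) / 2)
    (by linarith) (by linarith) ha (by rw [trapezoidHeight_symm ha]; linarith)
  rw [trapezoidHeight_symm ha] at this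
  have e : (a - m) / 2 * (2 * a + -h - h) / (a - h) = a - m := by field_simp; ring
  rw [← sub_eq_add_neg a h, e] at this
  rw [show -a + (a - m) = -m by ring, show a - (a - m) = m by ring] at this
  rw [this]
  ring

theorem setIntegral_trapezoid_sub_le (hl : -a < l) (hlr : l ≤ r) (hr : r < a) {τ : ℝ}
    (hτH : τ ≤ trapezoidHeight a l r) {A : Set ℝ} {c d : ℝ}
    (hA : MeasurableSet A) (hAc : A ⊆ Icc c d) :
    ∫ y in A, (trapezoid a l r y - τ) ≤ (trapezoidHeight a l r - τ) * (r - l) +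
      (2 * a + l - r) * (trapezoidHeight a l r - τ) ^ 2 / (2 * trapezoidHeight a l r) := by
  rw [← setIntegral_trapezoid_sub hl hlr hr hτH]
  refine setIntegral_le_setIntegral_of_sign hA measurableSet_Icc
    (integrableOn_trapezoid_sub τ hAc) (integrableOn_trapezoid_sub τ subset_rfl)
    (fun x hx => (trapezoid_sub_nonneg_iff hl hr hτH).2 hx)
    (fun x hx => ?_)
  by_contra hc
  exact hx.2 ((trapezoid_sub_nonneg_iff hl hr hτH).1 (not_le.1 hc).le)

/-- Among sets of given measure and trapezoids with given plateau length, the integral of the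
trapezoid over the set is largest in the centered situation. -/
theorem setIntegral_trapezoid_le (hl : -a < l) (hlr : l ≤ r) (hr : r < a)
    {A : Set ℝ} {c d : ℝ} (hA : MeasurableSet A) (hAc : A ⊆ Icc c d) {m : ℝ} (hm : 0 ≤ m)
    (hma : m ≤ a) (hv : volume A = ENNReal.ofReal (2 * m)) :
    ∫ y in A, trapezoid a l r y ≤
      ∫ y in Icc (-m) m, trapezoid a (-((r - l) / 2)) ((r - l) / 2) y := by
  set h := (r - l) / 2 with hh
  have hh0 : 0 ≤ h := by linarith
  have ha : h < a := by linarith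
  have hH := trapezoidHeight_le hl hr
  have hHpos := trapezoidHeight_pos hl hr
  have hvm : volume (Icc (-m) m) = ENNReal.ofReal (2 * m) := by
    rw [Real.volume_Icc]; congr 1; ring
  -- a level that bounds `trapezoid a l r` from above and the symmetric one from below
  have key : ∀ τ, (∀ y ∈ A, trapezoid a l r y ≤ τ) →
      (∀ y ∈ Icc (-m) m, τ ≤ trapezoid a (-h) h y) → ∫ y in A, trapezoid a l r y ≤
      ∫ y in Icc (-m) m, trapezoid a (-h) h y := by
    intro τ h1 h2
    rw [setIntegral_trapezoid_eq hAc hm hv τ,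
      setIntegral_trapezoid_eq (a := a) (l := -h) (r := h) subset_rfl hm hvm τ]
    have e1 : ∫ y in A, (trapezoid a l r y - τ) ≤ 0 :=
      setIntegral_nonpos hA fun y hy => sub_nonpos.2 (h1 y hy)
    have e2 : 0 ≤ ∫ y in Icc (-m) m, (trapezoid a (-h) h y - τ) :=
      setIntegral_nonneg measurableSet_Icc fun y hy => sub_nonneg.2 (h2 y hy)
    linarith
  rcases le_total m h with hmh | hmh
  · refine key ((a - h) / 2) (fun y _ => (trapezoid_le_height hl hr y).trans (by linarith))
      fun y hy => ?_
    rw [trapezoid_eq_height (by linarith) ha ⟨by linarith [hy.1], by linarith [hy.2]⟩,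
      trapezoidHeight_symm ha]
  -- For `h ≤ m`, the level `(a - m) / 2` is the value of the centered trapezoid at `±m`. Its
  -- superlevel set is then exactly `[-m, m]`, so the bathtub bound is attained there.
  rcases le_total (trapezoidHeight a l r) ((a - m) / 2) with hc | hc
  · refine key ((a - m) / 2) (fun y _ => (trapezoid_le_height hl hr y).trans hc) fun y hy => ?_
    rw [trapezoid_symm_eq ha]
    have := abs_le.2 hy
    have : a - m ≤ min (a - h) (a - |y|) := le_min (by linarith) (by linarith)
    linarith
  rw [setIntegral_trapezoid_eq hAc hm hv ((a - m) / 2),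
    setIntegral_trapezoid_eq (a := a) (l := -h) (r := h) subset_rfl hm hvm ((a - m) / 2),
    setIntegral_trapezoid_symm_sub hh0 ha hmh]
  have e1 := setIntegral_trapezoid_sub_le hl hlr hr hc hA hAc
  have hle : trapezoidHeight a l r ≤ (a - h) / 2 := by linarith
  have e2 := sq_sub_div_le hHpos (by linarith) hc hle
  have e3 : (2 * a + l - r) * (trapezoidHeight a l r - (a - m) / 2) ^ 2 /
      (2 * trapezoidHeight a l r) =
      (a - h) * ((trapezoidHeight a l r - (a - m) / 2) ^ 2 / trapezoidHeight a l r) := by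
    rw [hh]; field_simp; ring
  have e4 : 2 * (a - h) * (((a - h) / 2 - (a - m) / 2) ^ 2 / (2 * ((a - h) / 2))) =
      (a - h) * (((a - h) / 2 - (a - m) / 2) ^ 2 / ((a - h) / 2)) := by
    have : a - h ≠ 0 := by linarith
    field_simp
  rw [e3] at e1
  rw [e4]
  have e5 := mul_le_mul_of_nonneg_left e2 (by linarith : 0 ≤ a - h)
  have e6 : (trapezoidHeight a l r - (a - m) / 2) * (r - l) ≤
      ((a - h) / 2 - (a - m) / 2) * (2 * h) := by
    rw [show 2 * h = r - l by rw [hh]; ring]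
    exact mul_le_mul_of_nonneg_right (by linarith) (by linarith)
  linarith

/-- The equality case of `setIntegral_trapezoid_le` for degenerate trapezoids. -/
theorem volume_Ioo_diff_eq_zero_of_setIntegral_trapezoid_le {x : ℝ} (hl : -a < x) (hr : x < a)
    {A : Set ℝ} {c d : ℝ} (hA : MeasurableSet A) (hAc : A ⊆ Icc c d) {m : ℝ} (hm : 0 ≤ m)
    (hma : m ≤ a) (hv : volume A = ENNReal.ofReal (2 * m))
    (h : ∫ y in Icc (-m) m, trapezoid a 0 0 y ≤ ∫ y in A, trapezoid a x x y) :
    volume (Ioo (-m) m \ A) = 0 := by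
  rcases hm.eq_or_lt with rfl | hm0
  · simp
  have ha : 0 < a := by linarith
  have hvm : volume (Icc (-m) m) = ENNReal.ofReal (2 * m) := by
    rw [Real.volume_Icc]; congr 1; ring
  have hH := trapezoidHeight_le hl hr
  have hHpos := trapezoidHeight_pos hl hr
  rw [setIntegral_trapezoid_eq hAc hm hv ((a - m) / 2),
    setIntegral_trapezoid_eq (a := a) (l := 0) (r := 0) subset_rfl hm hvm ((a - m) / 2)] at h
  have hs := setIntegral_trapezoid_symm_sub (a := a) le_rfl ha hm
  rw [neg_zero] at hs
  have hs' : ∫ y in Icc (-m) m, (trapezoid a 0 0 y - (a - m) / 2) =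
      a * ((a / 2 - (a - m) / 2) ^ 2 / (a / 2)) := by
    rw [hs]; simp only [sub_zero, mul_zero, zero_add]; field_simp
  have hspos : 0 < ∫ y in Icc (-m) m, (trapezoid a 0 0 y - (a - m) / 2) := by
    rw [hs', show a / 2 - (a - m) / 2 = m / 2 by ring]; positivity
  have hc : (a - m) / 2 ≤ trapezoidHeight a x x := by
    by_contra hc
    have e1 : ∫ y in A, (trapezoid a x x y - (a - m) / 2) ≤ 0 :=
      setIntegral_nonpos hA fun y _ =>
        sub_nonpos.2 ((trapezoid_le_height hl hr y).trans (not_le.1 hc).le)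
    linarith
  -- The bathtub value increases strictly with the height, so equality forces the largest height `a
  -- / 2`, which only the pole `x = 0` has.
  have hHeq : trapezoidHeight a x x = a / 2 := by
    by_contra hne
    have hlt : trapezoidHeight a x x < a / 2 := lt_of_le_of_ne (by linarith) hne
    have e1 := setIntegral_trapezoid_sub_le hl le_rfl hr hc hA hAc
    have e2 := mul_lt_mul_of_pos_left (sq_sub_div_lt hHpos (by linarith) hc hlt) ha
    have e3 : (trapezoidHeight a x x - (a - m) / 2) * (x - x) +
        (2 * a + x - x) * (trapezoidHeight a x x - (a - m) / 2) ^ 2 / (2 * trapezoidHeight a x x)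
        = a * ((trapezoidHeight a x x - (a - m) / 2) ^ 2 / trapezoidHeight a x x) := by
      field_simp; ring
    linarith
  have hx0 : x = 0 := by
    unfold trapezoidHeight at hHeq
    rw [show 2 * a + x - x = 2 * a by ring, div_eq_div_iff (by linarith) (by norm_num)] at hHeq
    have : x ^ 2 = 0 := by nlinarith
    simpa using this
  subst hx0
  have hval : ∀ y, trapezoid a 0 0 y - (a - m) / 2 = (m - max 0 |y|) / 2 := by
    intro y
    have := trapezoid_symm_eq (a := a) ha y
    rw [neg_zero] at this
    rw [this, sub_zero, max_eq_right (abs_nonneg y), min_eq_right (by linarith [abs_nonneg y])]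
    ring
  refine volume_diff_eq_zero_of_setIntegral_le (F := fun y => trapezoid a 0 0 y - (a - m) / 2) hA
    measurableSet_Ioo (integrableOn_trapezoid_sub _ hAc)
    (integrableOn_trapezoid_sub _ Ioo_subset_Icc_self) (fun y hy => ?_) (fun y hy => ?_) ?_
  · have := abs_lt.2 hy
    simp only [hval, max_eq_right (abs_nonneg y)]
    linarith
  · have : m ≤ |y| := not_lt.1 fun hlt => hy.2 (abs_lt.1 hlt)
    simp only [hval, max_eq_right (abs_nonneg y)]
    linarith
  · rw [← integral_Icc_eq_integral_Ioo]
    linarith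

end trapezoid

/-! ### Layer cake and the Hardy-Littlewood inequality -/

/-- Layer cake formula for the integral of a product. -/
theorem lintegral_ofReal_mul_eq_lintegral_setIntegral {X : Set ℝ} (hX : MeasurableSet X)
    {f k : ℝ → ℝ} (hf : Measurable f) (hf0 : ∀ x, 0 ≤ f x) (hk : Continuous k)
    (hk0 : ∀ x ∈ X, 0 ≤ k x) (hkX : IntegrableOn k X) :
    ∫⁻ x in X, ENNReal.ofReal (f x * k x) =
      ∫⁻ t in Ioi 0, ENNReal.ofReal (∫ x in X ∩ {x | t < f x}, k x) := by
  have hkm : Measurable fun x => ENNReal.ofReal (k x) := hk.measurable.ennreal_ofReal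
  have h1 := lintegral_withDensity_eq_lintegral_mul (volume.restrict X) hkm hf.ennreal_ofReal
  have h2 := lintegral_eq_lintegral_meas_lt
    ((volume.restrict X).withDensity fun x => ENNReal.ofReal (k x))
    (Filter.Eventually.of_forall hf0) hf.aemeasurable
  rw [h1] at h2
  have h3 : ∫⁻ x in X, ENNReal.ofReal (f x * k x) =
      ∫⁻ x in X, ((fun x => ENNReal.ofReal (k x)) * fun x => ENNReal.ofReal (f x)) x :=
    lintegral_congr fun x => by simp [ENNReal.ofReal_mul (hf0 x), mul_comm]
  rw [h3, h2]
  refine lintegral_congr fun t => ?_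
  have hm : MeasurableSet {x | t < f x} := measurableSet_lt measurable_const hf
  rw [withDensity_apply _ hm, Measure.restrict_restrict hm, inter_comm,
    ofReal_integral_eq_lintegral_ofReal (hkX.mono_set inter_subset_left)]
  exact (ae_restrict_iff' (hX.inter hm)).2 (.of_forall fun x hx => hk0 x hx.1)

section HardyLittlewood

variable {a c : ℝ} {f g : ℝ → ℝ}

theorem volume_inter_Icc_eq (hc : 0 ≤ c) (f : ℝ → ℝ) (t : ℝ) :
    0 ≤ (volume (Icc (-c) c ∩ {x | t < f x})).toReal / 2 ∧
    (volume (Icc (-c) c ∩ {x | t < f x})).toReal / 2 ≤ c ∧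
    volume (Icc (-c) c ∩ {x | t < f x}) =
      ENNReal.ofReal (2 * ((volume (Icc (-c) c ∩ {x | t < f x})).toReal / 2)) := by
  have hle : volume (Icc (-c) c ∩ {x | t < f x}) ≤ ENNReal.ofReal (2 * c) := by
    refine (measure_mono inter_subset_left).trans_eq ?_
    rw [Real.volume_Icc]; congr 1; ring
  refine ⟨by positivity, ?_, ?_⟩
  · have := ENNReal.toReal_le_of_le_ofReal (by positivity) hle
    linarith
  · rw [mul_div_cancel₀ _ two_ne_zero, ENNReal.ofReal_toReal (hle.trans_lt ENNReal.ofReal_lt_top).ne]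

theorem setIntegral_trapezoid_superlevel_le (hc : 0 ≤ c) (hca : c < a) (hf : Measurable f)
    (hfg : ∀ t, 0 < t → (Icc (-c) c ∩ {x | t < g x} : Set ℝ) =ᵐ[volume]
      Icc (-((volume (Icc (-c) c ∩ {x | t < f x})).toReal / 2))
        ((volume (Icc (-c) c ∩ {x | t < f x})).toReal / 2))
    {l r : ℝ} (hl : -a < l) (hlr : l ≤ r) (hr : r < a) {t : ℝ} (ht : 0 < t) :
    ∫ x in Icc (-c) c ∩ {x | t < f x}, trapezoid a l r x ≤
      ∫ x in Icc (-c) c ∩ {x | t < g x}, trapezoid a (-((r - l) / 2)) ((r - l) / 2) x := by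
  obtain ⟨h1, h2, h3⟩ := volume_inter_Icc_eq hc f t
  rw [setIntegral_congr_set (hfg t ht)]
  exact setIntegral_trapezoid_le hl hlr hr
    (measurableSet_Icc.inter (measurableSet_lt measurable_const hf)) inter_subset_left h1
    (by linarith) h3

theorem lintegral_mul_trapezoid_le (hc : 0 ≤ c) (hca : c < a) (hf : Measurable f)
    (hf0 : ∀ x, 0 ≤ f x) (hg : Measurable g) (hg0 : ∀ x, 0 ≤ g x)
    (hfg : ∀ t, 0 < t → (Icc (-c) c ∩ {x | t < g x} : Set ℝ) =ᵐ[volume]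
      Icc (-((volume (Icc (-c) c ∩ {x | t < f x})).toReal / 2))
        ((volume (Icc (-c) c ∩ {x | t < f x})).toReal / 2))
    {l r : ℝ} (hl : -a < l) (hlr : l ≤ r) (hr : r < a) :
    ∫⁻ x in Icc (-c) c, ENNReal.ofReal (f x * trapezoid a l r x) ≤
      ∫⁻ x in Icc (-c) c,
        ENNReal.ofReal (g x * trapezoid a (-((r - l) / 2)) ((r - l) / 2) x) := by
  have hX : Icc (-c) c ⊆ Icc (-a) a := Icc_subset_Icc (by linarith) hca.le
  rw [lintegral_ofReal_mul_eq_lintegral_setIntegral measurableSet_Icc hf hf0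
      (continuous_trapezoid a l r) (fun x hx => trapezoid_nonneg hl hr (hX hx))
      (continuous_trapezoid a l r).integrableOn_Icc,
    lintegral_ofReal_mul_eq_lintegral_setIntegral measurableSet_Icc hg hg0
      (continuous_trapezoid a _ _)
      (fun x hx => trapezoid_nonneg (by linarith) (by linarith) (hX hx))
      (continuous_trapezoid a _ _).integrableOn_Icc]
  exact setLIntegral_mono' measurableSet_Ioi fun t ht => ENNReal.ofReal_le_ofReal
    (setIntegral_trapezoid_superlevel_le hc hca hf hfg hl hlr hr ht)

/-- The Hardy-Littlewood inequality for a trapezoidal kernel. -/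
theorem integral_mul_trapezoid_le (hc : 0 ≤ c) (hca : c < a) (hf : Measurable f)
    (hf0 : ∀ x, 0 ≤ f x) (hg : IntegrableOn g (Icc (-c) c)) (hgm : Measurable g)
    (hg0 : ∀ x, 0 ≤ g x)
    (hfg : ∀ t, 0 < t → (Icc (-c) c ∩ {x | t < g x} : Set ℝ) =ᵐ[volume]
      Icc (-((volume (Icc (-c) c ∩ {x | t < f x})).toReal / 2))
        ((volume (Icc (-c) c ∩ {x | t < f x})).toReal / 2))
    {l r : ℝ} (hl : -a < l) (hlr : l ≤ r) (hr : r < a) :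
    ∫ x in Icc (-c) c, f x * trapezoid a l r x ≤
      ∫ x in Icc (-c) c, g x * trapezoid a (-((r - l) / 2)) ((r - l) / 2) x := by
  have hX : Icc (-c) c ⊆ Icc (-a) a := Icc_subset_Icc (by linarith) hca.le
  have hgi : IntegrableOn (fun x => g x * trapezoid a (-((r - l) / 2)) ((r - l) / 2) x)
      (Icc (-c) c) := hg.mul_continuousOn (continuous_trapezoid a _ _).continuousOn isCompact_Icc
  have hfn : 0 ≤ᵐ[volume.restrict (Icc (-c) c)] fun x => f x * trapezoid a l r x :=
    (ae_restrict_iff' measurableSet_Icc).2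
      (.of_forall fun x hx => mul_nonneg (hf0 x) (trapezoid_nonneg hl hr (hX hx)))
  have hgn : 0 ≤ᵐ[volume.restrict (Icc (-c) c)]
      fun x => g x * trapezoid a (-((r - l) / 2)) ((r - l) / 2) x :=
    (ae_restrict_iff' measurableSet_Icc).2 (.of_forall fun x hx =>
      mul_nonneg (hg0 x) (trapezoid_nonneg (by linarith) (by linarith) (hX hx)))
  rw [integral_eq_lintegral_of_nonneg_ae hfn
      (hf.mul (continuous_trapezoid a l r).measurable).aestronglyMeasurable,
    integral_eq_lintegral_of_nonneg_ae hgn hgi.aestronglyMeasurable]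
  refine ENNReal.toReal_mono ?_ (lintegral_mul_trapezoid_le hc hca hf hf0 hgm hg0 hfg hl hlr hr)
  rw [← ofReal_integral_eq_lintegral_ofReal hgi hgn]
  exact ENNReal.ofReal_ne_top

/-- A countable dense set of good levels has a single exceptional null set; off it, a level strictly
between `f x` and `g x` would separate them. -/
theorem ae_eq_of_superlevel_ae_eq {X : Set ℝ} (hX : MeasurableSet X) (hf0 : ∀ x, 0 ≤ f x)
    (hg0 : ∀ x, 0 ≤ g x)
    (h : ∀ᵐ t ∂volume.restrict (Ioi (0 : ℝ)),
      (X ∩ {x | t < f x} : Set ℝ) =ᵐ[volume] (X ∩ {x | t < g x} : Set ℝ)) :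
    f =ᵐ[volume.restrict X] g := by
  rw [ae_restrict_iff' measurableSet_Ioi] at h
  obtain ⟨D, hD, hDc, hDd⟩ := (Measure.dense_of_ae h).exists_countable_dense_subset
  have hall : ∀ᵐ x, ∀ t ∈ D, 0 < t → (x ∈ X ∩ {x | t < f x} ↔ x ∈ X ∩ {x | t < g x}) := by
    rw [ae_ball_iff hDc]
    intro t ht
    by_cases h0 : 0 < t
    · filter_upwards [Filter.eventuallyEq_set.1 (hD ht h0)] with x hx _ using hx
    · exact .of_forall fun _ hh => absurd hh h0
  refine (ae_restrict_iff' hX).2 ?_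
  filter_upwards [hall] with x hx hxX
  rcases lt_trichotomy (f x) (g x) with hlt | heq | hlt
  · obtain ⟨t, ht, h1, h2⟩ := hDd.exists_between hlt
    have := ((hx t ht ((hf0 x).trans_lt h1)).2 ⟨hxX, h2⟩).2
    exact absurd h1 (not_lt.2 (le_of_lt this))
  · exact heq
  · obtain ⟨t, ht, h1, h2⟩ := hDd.exists_between hlt
    have := ((hx t ht ((hg0 x).trans_lt h1)).1 ⟨hxX, h2⟩).2
    exact absurd h1 (not_lt.2 (le_of_lt this))

/-- The equality case of `integral_mul_trapezoid_le` for degenerate trapezoids. -/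
theorem ae_eq_of_integral_mul_trapezoid_le (hc : 0 ≤ c) (hca : c < a) (hf : Measurable f)
    (hfi : IntegrableOn f (Icc (-c) c)) (hf0 : ∀ x, 0 ≤ f x) (hg : IntegrableOn g (Icc (-c) c))
    (hgm : Measurable g) (hg0 : ∀ x, 0 ≤ g x)
    (hfg : ∀ t, 0 < t → (Icc (-c) c ∩ {x | t < g x} : Set ℝ) =ᵐ[volume]
      Icc (-((volume (Icc (-c) c ∩ {x | t < f x})).toReal / 2))
        ((volume (Icc (-c) c ∩ {x | t < f x})).toReal / 2))
    {x : ℝ} (hl : -a < x) (hr : x < a)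
    (h : ∫ y in Icc (-c) c, g y * trapezoid a 0 0 y ≤
      ∫ y in Icc (-c) c, f y * trapezoid a x x y) :
    f =ᵐ[volume.restrict (Icc (-c) c)] g := by
  have ha : 0 < a := by linarith
  have hX : Icc (-c) c ⊆ Icc (-a) a := Icc_subset_Icc (by linarith) hca.le
  have hfi' : IntegrableOn (fun y => f y * trapezoid a x x y) (Icc (-c) c) :=
    hfi.mul_continuousOn (continuous_trapezoid a _ _).continuousOn isCompact_Icc
  have hgi' : IntegrableOn (fun y => g y * trapezoid a 0 0 y) (Icc (-c) c) :=
    hg.mul_continuousOn (continuous_trapezoid a _ _).continuousOn isCompact_Icc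
  have hfn : 0 ≤ᵐ[volume.restrict (Icc (-c) c)] fun y => f y * trapezoid a x x y :=
    (ae_restrict_iff' measurableSet_Icc).2
      (.of_forall fun y hy => mul_nonneg (hf0 y) (trapezoid_nonneg hl hr (hX hy)))
  have hgn : 0 ≤ᵐ[volume.restrict (Icc (-c) c)] fun y => g y * trapezoid a 0 0 y :=
    (ae_restrict_iff' measurableSet_Icc).2 (.of_forall fun y hy =>
      mul_nonneg (hg0 y) (trapezoid_nonneg (by linarith) ha (hX hy)))
  have hle := ENNReal.ofReal_le_ofReal h
  rw [ofReal_integral_eq_lintegral_ofReal hfi' hfn,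
    ofReal_integral_eq_lintegral_ofReal hgi' hgn] at hle
  have hfin : ∫⁻ y in Icc (-c) c, ENNReal.ofReal (f y * trapezoid a x x y) ≠ ⊤ := by
    rw [← ofReal_integral_eq_lintegral_ofReal hfi' hfn]; exact ENNReal.ofReal_ne_top
  rw [lintegral_ofReal_mul_eq_lintegral_setIntegral measurableSet_Icc hf hf0
      (continuous_trapezoid a x x) (fun x hx => trapezoid_nonneg hl hr (hX hx))
      (continuous_trapezoid a x x).integrableOn_Icc] at hle hfin
  rw [lintegral_ofReal_mul_eq_lintegral_setIntegral measurableSet_Icc hgm hg0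
      (continuous_trapezoid a _ _)
      (fun x hx => trapezoid_nonneg (by linarith) (by linarith) (hX hx))
      (continuous_trapezoid a _ _).integrableOn_Icc] at hle
  have hpt : ∀ t, 0 < t → ∫ y in Icc (-c) c ∩ {y | t < f y}, trapezoid a x x y ≤
      ∫ y in Icc (-c) c ∩ {y | t < g y}, trapezoid a 0 0 y := by
    intro t ht
    simpa using setIntegral_trapezoid_superlevel_le hc hca hf hfg hl le_rfl hr ht
  -- Monotonicity in `t` provides the measurability needed to pass from equal integrals over the
  -- levels to equality at almost every level.
  have hanti : Antitone fun t =>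
      ENNReal.ofReal (∫ y in Icc (-c) c ∩ {y | t < g y}, trapezoid a 0 0 y) := by
    intro s t hst
    refine ENNReal.ofReal_le_ofReal (setIntegral_mono_set
      ((continuous_trapezoid a 0 0).integrableOn_Icc.mono_set inter_subset_left) ?_ ?_)
    · exact (ae_restrict_iff' (measurableSet_Icc.inter
        (measurableSet_lt measurable_const hgm))).2
        (.of_forall fun y hy => trapezoid_nonneg (by linarith) ha (hX hy.1))
    · exact Filter.Eventually.of_forall fun y hy => ⟨hy.1, hst.trans_lt hy.2⟩
  have hae := ae_eq_of_ae_le_of_lintegral_le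
    ((ae_restrict_iff' measurableSet_Ioi).2
      (.of_forall fun t ht => ENNReal.ofReal_le_ofReal (hpt t ht)))
    hfin hanti.measurable.aemeasurable hle
  refine ae_eq_of_superlevel_ae_eq measurableSet_Icc hf0 hg0 ?_
  filter_upwards [hae, ae_restrict_mem measurableSet_Ioi] with t ht ht0
  obtain ⟨h1, h2, h3⟩ := volume_inter_Icc_eq hc f t
  have hA : MeasurableSet (Icc (-c) c ∩ {x | t < f x}) :=
    measurableSet_Icc.inter (measurableSet_lt measurable_const hf)
  have hnn : 0 ≤ ∫ y in Icc (-c) c ∩ {y | t < f y}, trapezoid a x x y :=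
    setIntegral_nonneg hA fun y hy => trapezoid_nonneg hl hr (hX hy.1)
  have hzero := volume_Ioo_diff_eq_zero_of_setIntegral_trapezoid_le hl hr hA inter_subset_left h1
    (by linarith) h3 (by
      rw [← setIntegral_congr_set (hfg t ht0)]
      exact (ENNReal.ofReal_eq_ofReal_iff hnn (hnn.trans (hpt t ht0))).1 ht |>.ge)
  refine Filter.EventuallyEq.trans ?_ (hfg t ht0).symm
  refine Filter.EventuallyEq.trans ?_ Ioo_ae_eq_Icc
  refine (ae_eq_of_ae_subset_of_measure_ge (ae_le_set.2 hzero) (le_of_eq ?_)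
    measurableSet_Ioo.nullMeasurableSet (by rw [h3]; exact ENNReal.ofReal_ne_top)).symm
  rw [Real.volume_Ioo, sub_neg_eq_add, ← two_mul]
  exact h3

end HardyLittlewood

/-! ### The symmetric decreasing rearrangement as a real function -/

theorem volume_restrict_superlevel_Icc (c : ℝ) (f : ℝ → ℝ) (s : ℝ) :
    volume.restrict (Icc (-c) c) {x | s < f x} = volume {x | x ∈ Icc (-c) c ∧ s < f x} := by
  rw [Measure.restrict_apply' measurableSet_Icc, inter_comm]; rfl

/-- Away from the center and the endpoints the value is finite: negative levels have superlevel sets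
of full measure, and Markov's inequality supplies an admissible level. The equivalence rests on
right continuity of the distribution function. -/
theorem symmDecreasingRearrangement_eq_coe {c : ℝ} {f : ℝ → ℝ}
    (hf : IntegrableOn f (Icc (-c) c)) (hf0 : ∀ᵐ x ∂volume.restrict (Icc (-c) c), 0 ≤ f x)
    {x : ℝ} (hx0 : x ≠ 0) (hx : |x| < c) :
    ∃ y : ℝ, 0 ≤ y ∧ symmDecreasingRearrangement (Icc (-c) c) f x = (y : EReal) ∧
      ∀ s, s < y ↔ ENNReal.ofReal (2 * |x|) < volume {z | z ∈ Icc (-c) c ∧ s < f z} := by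
  have hpos : 0 < |x| := abs_pos.2 hx0
  have hvX : volume (Icc (-c) c) = ENNReal.ofReal (2 * c) := by
    rw [Real.volume_Icc]; congr 1; ring
  set S := {s : ℝ | volume {z | z ∈ Icc (-c) c ∧ s < f z} ≤ ENNReal.ofReal (2 * |x|)} with hS
  have hS0 : ∀ s ∈ S, 0 ≤ s := by
    intro s hs
    by_contra hneg
    have hfull : volume {z | z ∈ Icc (-c) c ∧ s < f z} = volume (Icc (-c) c) := by
      rw [← volume_restrict_superlevel_Icc, ← Measure.restrict_apply_univ (Icc (-c) c)]
      refine measure_congr ?_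
      filter_upwards [hf0] with z hz
      exact propext ⟨fun _ => trivial, fun _ => (not_le.1 hneg).trans_le hz⟩
    have hs' : volume {z | z ∈ Icc (-c) c ∧ s < f z} ≤ ENNReal.ofReal (2 * |x|) := hs
    rw [hfull, hvX, ENNReal.ofReal_le_ofReal_iff (by positivity)] at hs'
    linarith
  have hSne : S.Nonempty := by
    set I := ∫ z in Icc (-c) c, f z
    have hI : 0 ≤ I := integral_nonneg_of_ae hf0
    -- Chosen so that `s * (2 * |x|) = I + 1` exceeds the integral `I`, as Markov's inequality
    -- requires.
    set s := (I + 1) / (2 * |x|)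
    have hspos : 0 < s := by positivity
    refine ⟨s, ?_⟩
    have hM := mul_meas_ge_le_integral_of_nonneg hf0 hf s
    have hM' : (volume.restrict (Icc (-c) c)).real {z | s ≤ f z} ≤ 2 * |x| := by
      have e : s * (2 * |x|) = I + 1 := by
        simp only [s]; field_simp
      by_contra hc
      have := mul_lt_mul_of_pos_left (not_le.1 hc) hspos
      linarith
    change volume {z | z ∈ Icc (-c) c ∧ s < f z} ≤ ENNReal.ofReal (2 * |x|)
    rw [← volume_restrict_superlevel_Icc]
    refine (measure_mono (t := {z | s ≤ f z}) fun z (hz : s < f z) => hz.le).trans ?_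
    rw [← ENNReal.ofReal_toReal (measure_ne_top (volume.restrict (Icc (-c) c)) {z | s ≤ f z})]
    exact ENNReal.ofReal_le_ofReal hM'
  have hbdd : BddBelow S := ⟨0, hS0⟩
  refine ⟨sInf S, le_csInf hSne hS0, ?_, fun s => ?_⟩
  · rw [symmDecreasingRearrangement, decreasingRearrangement, if_neg (by positivity), if_pos]
    · apply IsGLB.sInf_eq
      have h := isGLB_csInf hSne hbdd
      refine ⟨?_, fun b hb => ?_⟩
      · rintro _ ⟨s, hs, rfl⟩
        exact EReal.coe_le_coe_iff.2 (h.1 hs)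
      · induction b with
        | bot => exact bot_le
        | coe b =>
          exact EReal.coe_le_coe_iff.2 (h.2 fun s hs => EReal.coe_le_coe_iff.1 (hb ⟨s, hs, rfl⟩))
        | top =>
          obtain ⟨s, hs⟩ := hSne
          exact absurd (hb ⟨s, hs, rfl⟩) (not_le.2 (EReal.coe_lt_top s))
    · rw [hvX]
      exact (ENNReal.ofReal_lt_ofReal_iff (by linarith)).2 (by linarith)
  · constructor
    · intro hs
      by_contra hc
      exact absurd (csInf_le hbdd (show s ∈ S from not_lt.1 hc)) (not_le.2 hs)
    · intro hs
      -- Right continuity: some level strictly above `s` still has a superlevel set of measure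
      -- larger than `2 * |x|`, so it bounds `S` from below.
      have hU : {z | z ∈ Icc (-c) c ∧ s < f z} =
          ⋃ n : ℕ, {z | z ∈ Icc (-c) c ∧ s + 1 / ((n : ℝ) + 1) < f z} := by
        ext z
        simp only [mem_ofPred_eq, mem_iUnion]
        constructor
        · rintro ⟨h1, h2⟩
          obtain ⟨n, hn⟩ := exists_nat_one_div_lt (sub_pos.2 h2)
          exact ⟨n, h1, by linarith⟩
        · rintro ⟨n, h1, h2⟩
          exact ⟨h1, lt_trans (lt_add_of_pos_right _ Nat.one_div_pos_of_nat) h2⟩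
      have hmono : Monotone fun n : ℕ => {z | z ∈ Icc (-c) c ∧ s + 1 / ((n : ℝ) + 1) < f z} := by
        intro m n hmn z hz
        refine ⟨hz.1, lt_of_le_of_lt ?_ hz.2⟩
        have := Nat.one_div_le_one_div (α := ℝ) hmn
        linarith
      rw [hU, hmono.measure_iUnion, lt_iSup_iff] at hs
      obtain ⟨n, hn⟩ := hs
      have hle : s + 1 / ((n : ℝ) + 1) ≤ sInf S := by
        refine le_csInf hSne fun b hb => ?_
        by_contra hbn
        refine absurd (le_trans (measure_mono ?_) (show _ ≤ _ from hb)) (not_le.2 hn)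
        exact fun z hz => ⟨hz.1, (not_le.1 hbn).trans hz.2⟩
      exact lt_of_lt_of_le (lt_add_of_pos_right _ Nat.one_div_pos_of_nat) hle

/-- A real-valued version of the symmetric decreasing rearrangement. -/
theorem exists_real_symmDecreasingRearrangement {c : ℝ} (hc : 0 < c) {f : ℝ → ℝ}
    (hf : IntegrableOn f (Icc (-c) c)) (hf0 : ∀ᵐ x ∂volume.restrict (Icc (-c) c), 0 ≤ f x) :
    ∃ g : ℝ → ℝ, Measurable g ∧ (∀ x, 0 ≤ g x) ∧ (∀ x, g (-x) = g x) ∧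
      (∀ᵐ x ∂volume.restrict (Icc (-c) c),
        symmDecreasingRearrangement (Icc (-c) c) f x = (g x : EReal)) ∧
      ∀ t, 0 ≤ t → (Icc (-c) c ∩ {x | t < g x} : Set ℝ) =ᵐ[volume]
        Icc (-((volume (Icc (-c) c ∩ {x | t < f x})).toReal / 2))
          ((volume (Icc (-c) c ∩ {x | t < f x})).toReal / 2) := by
  classical
  set g : ℝ → ℝ := fun x => if x ≠ 0 ∧ |x| < c then
    (symmDecreasingRearrangement (Icc (-c) c) f x).toReal else 0 with hg
  have hspec : ∀ x, x ≠ 0 → |x| < c → 0 ≤ g x ∧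
      symmDecreasingRearrangement (Icc (-c) c) f x = (g x : EReal) ∧
      ∀ s, s < g x ↔ ENNReal.ofReal (2 * |x|) < volume {z | z ∈ Icc (-c) c ∧ s < f z} := by
    intro x hx0 hx
    obtain ⟨y, h1, h2, h3⟩ := symmDecreasingRearrangement_eq_coe hf hf0 hx0 hx
    have : g x = y := by simp only [hg]; rw [if_pos ⟨hx0, hx⟩, h2, EReal.toReal_coe]
    rw [this]
    exact ⟨h1, h2, h3⟩
  have hg0 : ∀ x, 0 ≤ g x := by
    intro x
    by_cases h : x ≠ 0 ∧ |x| < c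
    · exact (hspec x h.1 h.2).1
    · simp only [hg]; rw [if_neg h]
  have hlevel : ∀ t, 0 ≤ t → {x | t < g x} =
      {x | (x ≠ 0 ∧ |x| < c) ∧
        ENNReal.ofReal (2 * |x|) < volume {z | z ∈ Icc (-c) c ∧ t < f z}} := by
    intro t ht
    ext x
    by_cases h : x ≠ 0 ∧ |x| < c
    · simp only [mem_ofPred_eq, (hspec x h.1 h.2).2.2, h, true_and, ne_eq, not_false_eq_true]
    · simp only [mem_ofPred_eq, h, false_and, iff_false, hg]
      simpa using ht
  refine ⟨g, ?_, hg0, ?_, ?_, ?_⟩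
  · refine measurable_of_Ioi fun t => ?_
    change MeasurableSet {x | t < g x}
    rcases lt_or_ge t 0 with ht | ht
    · have : {x | t < g x} = univ := eq_univ_of_forall fun x => ht.trans_le (hg0 x)
      rw [this]; exact .univ
    · rw [hlevel t ht]
      have hm : Measurable fun x : ℝ => ENNReal.ofReal (2 * |x|) :=
        (measurable_const.mul measurable_norm).ennreal_ofReal
      exact ((measurableSet_singleton 0).compl.inter
        (measurableSet_lt measurable_norm measurable_const)).inter
        (measurableSet_lt hm measurable_const)
  · intro x
    simp only [hg, symmDecreasingRearrangement, abs_neg, neg_eq_zero, ne_eq]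
  · rw [ae_restrict_iff' measurableSet_Icc]
    have h : ∀ᵐ x : ℝ, x ∉ ({0, -c, c} : Set ℝ) :=
      compl_mem_ae_iff.2 ((Set.toFinite ({0, -c, c} : Set ℝ)).measure_zero _)
    filter_upwards [h] with x hx hxX
    simp only [mem_insert_iff, mem_singleton_iff, not_or] at hx
    refine (hspec x hx.1 (abs_lt.2 ⟨lt_of_le_of_ne hxX.1 (Ne.symm hx.2.1),
      lt_of_le_of_ne hxX.2 hx.2.2⟩)).2.1
  · intro t ht
    obtain ⟨h1, h2, h3⟩ := volume_inter_Icc_eq hc.le f t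
    set m := (volume (Icc (-c) c ∩ {x | t < f x})).toReal / 2
    -- The origin is missing because `g 0 = 0` by convention: the rearrangement may be infinite
    -- there.
    have hset : (Icc (-c) c ∩ {x | t < g x} : Set ℝ) = Ioo (-m) m \ {0} := by
      rw [hlevel t ht]
      ext x
      have h3' : volume {z | z ∈ Icc (-c) c ∧ t < f z} = ENNReal.ofReal (2 * m) := h3
      rw [h3']
      simp only [mem_inter_iff, mem_ofPred_eq, mem_sdiff, mem_singleton_iff]
      rw [ENNReal.ofReal_lt_ofReal_iff_of_nonneg (by positivity), mul_lt_mul_iff_right₀ two_pos,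
        abs_lt, abs_lt]
      constructor
      · rintro ⟨-, ⟨h, -⟩, h'⟩; exact ⟨h', h⟩
      · rintro ⟨h', h⟩
        exact ⟨⟨by linarith [h'.1], by linarith [h'.2]⟩,
          ⟨h, by linarith [h'.1], by linarith [h'.2]⟩, h'⟩
    rw [hset]
    exact (sdiff_null_ae_eq_self (measure_singleton 0)).trans Ioo_ae_eq_Icc

/-! ### Green's formula for the Robin problem -/

namespace IsRobinSolution

variable {α : ℝ} {G : ℝ → EReal} {w g : ℝ → ℝ}

theorem deriv_ae_eq (hw : IsRobinSolution α G w)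
    (hG : ∀ᵐ x ∂volume.restrict (Icc (-π) π), G x = (g x : EReal)) :
    ∀ᵐ x, x ∈ Icc (-π) π → g x = -deriv (derivWithin w (Icc (-π) π)) x := by
  have h := hw.poisson
  rw [restrict_Ioo_eq_restrict_Icc, ae_restrict_iff' measurableSet_Icc] at h
  rw [ae_restrict_iff' measurableSet_Icc] at hG
  filter_upwards [h, hG] with x h1 h2 hx
  obtain ⟨d, hd, hdG⟩ := h1 hx
  rw [hd.deriv]
  rw [h2 hx] at hdG
  exact (EReal.coe_eq_coe_iff.1 hdG).symm

theorem integrableOn (hw : IsRobinSolution α G w)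
    (hG : ∀ᵐ x ∂volume.restrict (Icc (-π) π), G x = (g x : EReal)) :
    IntegrableOn g (Icc (-π) π) := by
  have h := hw.absolutelyContinuous.intervalIntegrable_deriv.neg
  rw [intervalIntegrable_iff_integrableOn_Icc_of_le (by linarith [pi_pos])] at h
  refine h.congr ?_
  refine (ae_restrict_iff' measurableSet_Icc).2 ?_
  filter_upwards [hw.deriv_ae_eq hG] with x hx hxX
  exact (hx hxX).symm

theorem integral_derivWithin (hw : IsRobinSolution α G w) {p q : ℝ} (hp : -π ≤ p) (hpq : p ≤ q)
    (hq : q ≤ π) : ∫ x in p..q, derivWithin w (Icc (-π) π) x = w q - w p := by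
  have hsub : Icc p q ⊆ Icc (-π) π := Icc_subset_Icc hp hq
  refine intervalIntegral.integral_eq_sub_of_hasDerivAt_of_le hpq
    (hw.contDiffOn.continuousOn.mono hsub) (fun x hx => ?_) ?_
  · have hx' : x ∈ Ioo (-π) π := ⟨hp.trans_lt hx.1, hx.2.trans_le hq⟩
    exact ((hw.contDiffOn.differentiableOn one_ne_zero x
      (Ioo_subset_Icc_self hx')).hasDerivWithinAt).hasDerivAt (Icc_mem_nhds hx'.1 hx'.2)
  · refine ContinuousOn.intervalIntegrable ?_
    rw [uIcc_of_le hpq]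
    have := hw.absolutelyContinuous.continuousOn
    rw [uIcc_of_le (by linarith [pi_pos])] at this
    exact this.mono hsub

/-- One integration by parts, legitimate because `w'` is absolutely continuous. Used on each of the
three affine pieces of a trapezoid. -/
theorem integral_mul_affine (hw : IsRobinSolution α G w)
    (hG : ∀ᵐ x ∂volume.restrict (Icc (-π) π), G x = (g x : EReal))
    {p q : ℝ} (hp : -π ≤ p) (hpq : p ≤ q) (hq : q ≤ π) (β γ : ℝ) :
    ∫ x in p..q, g x * (β * x + γ) =
      (β * p + γ) * derivWithin w (Icc (-π) π) p - (β * q + γ) * derivWithin w (Icc (-π) π) q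
        + β * (w q - w p) := by
  set w' := derivWithin w (Icc (-π) π) with hw'
  have hsub : Icc p q ⊆ Icc (-π) π := Icc_subset_Icc hp hq
  have hF : AbsolutelyContinuousOnInterval (fun x => β * x + γ) p q :=
    ContDiffOn.absolutelyContinuousOnInterval (by fun_prop)
  have hac : AbsolutelyContinuousOnInterval w' p q := by
    refine hw.absolutelyContinuous.mono ?_
    rwa [uIcc_of_le hpq, uIcc_of_le (by linarith [pi_pos])]
  have h := hF.integral_mul_deriv_eq_deriv_mul hac
  have hd : ∀ x, deriv (fun x : ℝ => β * x + γ) x = β := fun x => by simp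
  simp only [hd, intervalIntegral.integral_const_mul] at h
  rw [hw', hw.integral_derivWithin hp hpq hq, ← hw'] at h
  have e : ∫ x in p..q, g x * (β * x + γ) = ∫ x in p..q, -((β * x + γ) * deriv w' x) := by
    refine intervalIntegral.integral_congr_ae ?_
    filter_upwards [hw.deriv_ae_eq hG] with x hx hxI
    rw [uIoc_of_le hpq] at hxI
    rw [hx (hsub (Ioc_subset_Icc_self hxI)), ← hw']
    ring
  rw [e, intervalIntegral.integral_neg, h]
  ring

/-- Green's representation formula, tested against a trapezoid. -/
theorem integral_mul_trapezoid (hα : 0 < α) (hw : IsRobinSolution α G w)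
    (hG : ∀ᵐ x ∂volume.restrict (Icc (-π) π), G x = (g x : EReal))
    {l r : ℝ} (hl : -π ≤ l) (hlr : l ≤ r) (hr : r ≤ π) :
    ∫ x in Icc (-π) π, g x * trapezoid (π + 1 / α) l r x =
      ((π + 1 / α - r) * w l + (π + 1 / α + l) * w r) / (2 * (π + 1 / α) + l - r) := by
  have hα' : 0 < 1 / α := by positivity
  set a := π + 1 / α with ha
  have hl' : -a < l := by linarith
  have hr' : r < a := by linarith
  have hI : ∀ p q, -π ≤ p → p ≤ q → q ≤ π →
      IntervalIntegrable (fun x => g x * trapezoid a l r x) volume p q := by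
    intro p q hp hpq hq
    rw [intervalIntegrable_iff_integrableOn_Icc_of_le hpq]
    exact ((hw.integrableOn hG).mul_continuousOn (continuous_trapezoid a l r).continuousOn
      isCompact_Icc).mono_set (Icc_subset_Icc hp hq)
  rw [integral_Icc_eq_integral_Ioc, ← intervalIntegral.integral_of_le (by linarith),
    ← intervalIntegral.integral_add_adjacent_intervals (hI (-π) l le_rfl hl (by linarith))
      (hI l π hl (by linarith) le_rfl),
    ← intervalIntegral.integral_add_adjacent_intervals (hI l r hl hlr hr)
      (hI r π (by linarith) hr le_rfl)]
  set D := 2 * a + l - r with hD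
  have hDpos : 0 < D := by linarith
  have e1 : ∫ x in (-π)..l, g x * trapezoid a l r x =
      ∫ x in (-π)..l, g x * ((a - r) / D * x + (a - r) * a / D) := by
    refine intervalIntegral.integral_congr fun y hy => ?_
    rw [uIcc_of_le hl] at hy
    simp only [trapezoid_eq_left hl' hlr hr' hy.2]
    ring
  have e2 : ∫ x in l..r, g x * trapezoid a l r x =
      ∫ x in l..r, g x * (0 * x + (a + l) * (a - r) / D) := by
    refine intervalIntegral.integral_congr fun y hy => ?_
    rw [uIcc_of_le hlr] at hy
    simp only [trapezoid_eq_height hl' hr' hy, trapezoidHeight]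
    ring
  have e3 : ∫ x in r..π, g x * trapezoid a l r x =
      ∫ x in r..π, g x * (-(a + l) / D * x + (a + l) * a / D) := by
    refine intervalIntegral.integral_congr fun y hy => ?_
    rw [uIcc_of_le hr] at hy
    simp only [trapezoid_eq_right hl' hlr hr' hy.1]
    ring
  rw [e1, e2, e3, hw.integral_mul_affine hG le_rfl hl (by linarith),
    hw.integral_mul_affine hG hl hlr hr, hw.integral_mul_affine hG (by linarith) hr le_rfl]
  have b1 : derivWithin w (Icc (-π) π) (-π) = α * w (-π) := by linarith [hw.robin_left]
  have b2 : derivWithin w (Icc (-π) π) π = -(α * w π) := by linarith [hw.robin_right]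
  rw [b1, b2]
  -- This relation is why `a = π + 1/α`: it makes the boundary terms at `±π` cancel under the Robin
  -- conditions.
  have h1 : (a - π) * α = 1 := by rw [ha]; field_simp; ring
  rw [eq_div_iff hDpos.ne']
  have c1 : (a - r) / D * (-π) + (a - r) * a / D = (a - r) * (a - π) / D := by ring
  have c2 : -(a + l) / D * π + (a + l) * a / D = (a + l) * (a - π) / D := by ring
  rw [c1, c2]
  field_simp
  linear_combination ((a - r) * w (-π) + (a + l) * w π) * h1

theorem eq_integral_mul_trapezoid (hα : 0 < α) (hw : IsRobinSolution α G w)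
    (hG : ∀ᵐ x ∂volume.restrict (Icc (-π) π), G x = (g x : EReal))
    {x : ℝ} (hx : x ∈ Icc (-π) π) :
    w x = ∫ y in Icc (-π) π, g y * trapezoid (π + 1 / α) x x y := by
  have hα' : 0 < 1 / α := by positivity
  have : π + 1 / α ≠ 0 := by linarith [pi_pos]
  rw [hw.integral_mul_trapezoid hα hG hx.1 le_rfl hx.2,
    show (π + 1 / α - x) * w x + (π + 1 / α + x) * w x = (2 * (π + 1 / α)) * w x by ring,
    add_sub_cancel_right, mul_div_cancel_left₀ _ (by positivity)]

end IsRobinSolution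

/-! ### From the two-point inequality to distribution functions and norms -/

section comparison

variable {c : ℝ} {u v : ℝ → ℝ}

/-- If two points of the left set are `2 * h` apart, then `[-h, h]` lies in the right set, so the
diameter of the left set is already bounded. The general codomain `β` covers both real `φ` and
`ENNReal.ofReal`, the latter for the essential supremum. -/
theorem volume_superlevel_comp_le {β : Type*} [LinearOrder β]
    (huv : ∀ x ∈ Icc (-c) c, ∀ y ∈ Icc (-c) c, x ≤ y → min (u x) (u y) ≤ v ((y - x) / 2))
    (heven : ∀ x ∈ Icc (-c) c, v (-x) = v x) (hanti : AntitoneOn v (Icc 0 c))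
    {φ : ℝ → β} (hφ : Monotone φ) (s : β) :
    volume (Icc (-c) c ∩ {x | s < φ (u x)}) ≤ volume (Icc (-c) c ∩ {x | s < φ (v x)}) := by
  refine (Real.volume_le_diam _).trans (Metric.ediam_le ?_)
  have key : ∀ x ∈ Icc (-c) c ∩ {x | s < φ (u x)}, ∀ y ∈ Icc (-c) c ∩ {x | s < φ (u x)}, x ≤ y →
      edist x y ≤ volume (Icc (-c) c ∩ {x | s < φ (v x)}) := by
    rintro x ⟨hx, hx'⟩ y ⟨hy, hy'⟩ hxy
    set h := (y - x) / 2 with hh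
    have hhc : h ≤ c := by linarith [hx.1, hy.2]
    have hvol : edist x y = volume (Icc (-h) h) := by
      rw [Real.volume_Icc, edist_comm, edist_dist, Real.dist_eq, abs_of_nonneg (by linarith)]
      congr 1; ring
    rw [hvol]
    refine measure_mono fun z hz => ?_
    have hzh : |z| ≤ h := abs_le.2 hz
    have hzc : z ∈ Icc (-c) c := abs_le.1 (hzh.trans hhc)
    refine ⟨hzc, ?_⟩
    have hvz : v z = v |z| := by
      rcases abs_cases z with ⟨e, _⟩ | ⟨e, _⟩
      · rw [e]
      · rw [e, heven z hzc]
    have hle : min (u x) (u y) ≤ v z := by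
      rw [hvz]
      exact (huv x hx y hy hxy).trans
        (hanti ⟨abs_nonneg z, hzh.trans hhc⟩ ⟨(abs_nonneg z).trans hzh, hhc⟩ hzh)
    refine lt_of_lt_of_le ?_ (hφ hle)
    rw [hφ.map_min]
    exact lt_min hx' hy'
  intro x hx y hy
  rcases le_total x y with hxy | hxy
  · exact key x hx y hy hxy
  · rw [edist_comm]; exact key y hy x hx hxy

theorem aemeasurable_comp_of_monotone (hu : ContinuousOn u (Icc (-c) c)) {φ : ℝ → ℝ}
    (hφ : Monotone φ) : AEMeasurable (fun x => φ (u x)) (volume.restrict (Icc (-c) c)) :=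
  hφ.measurable.comp_aemeasurable (hu.aemeasurable measurableSet_Icc)

theorem integrableOn_comp_of_monotone (hu : ContinuousOn u (Icc (-c) c)) {φ : ℝ → ℝ}
    (hφ : Monotone φ) : IntegrableOn (fun x => φ (u x)) (Icc (-c) c) := by
  obtain ⟨C, hC⟩ := isCompact_Icc.exists_bound_of_continuousOn hu
  refine Integrable.of_bound (aemeasurable_comp_of_monotone hu hφ).aestronglyMeasurable
    (max |φ (-C)| |φ C|) ?_
  refine (ae_restrict_iff' measurableSet_Icc).2 (.of_forall fun x hx => ?_)
  have := abs_le.1 (hC x hx)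
  exact abs_le_max_abs_abs (hφ this.1) (hφ this.2)

theorem lintegral_comp_le (hu : ContinuousOn u (Icc (-c) c)) (hv : ContinuousOn v (Icc (-c) c))
    (huv : ∀ x ∈ Icc (-c) c, ∀ y ∈ Icc (-c) c, x ≤ y → min (u x) (u y) ≤ v ((y - x) / 2))
    (heven : ∀ x ∈ Icc (-c) c, v (-x) = v x) (hanti : AntitoneOn v (Icc 0 c))
    {φ : ℝ → ℝ} (hφ : Monotone φ) (hφ0 : ∀ y, 0 ≤ φ y) :
    ∫⁻ x in Icc (-c) c, ENNReal.ofReal (φ (u x)) ≤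
      ∫⁻ x in Icc (-c) c, ENNReal.ofReal (φ (v x)) := by
  rw [lintegral_eq_lintegral_meas_lt _ (.of_forall fun x => hφ0 (u x))
      (aemeasurable_comp_of_monotone hu hφ),
    lintegral_eq_lintegral_meas_lt _ (.of_forall fun x => hφ0 (v x))
      (aemeasurable_comp_of_monotone hv hφ)]
  refine lintegral_mono fun s => ?_
  simp only [Measure.restrict_apply' (measurableSet_Icc (a := -c) (b := c))]
  rw [inter_comm, inter_comm _ (Icc (-c) c)]
  exact volume_superlevel_comp_le huv heven hanti hφ s

theorem integral_comp_le (hu : ContinuousOn u (Icc (-c) c)) (hv : ContinuousOn v (Icc (-c) c))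
    (huv : ∀ x ∈ Icc (-c) c, ∀ y ∈ Icc (-c) c, x ≤ y → min (u x) (u y) ≤ v ((y - x) / 2))
    (heven : ∀ x ∈ Icc (-c) c, v (-x) = v x) (hanti : AntitoneOn v (Icc 0 c))
    {φ : ℝ → ℝ} (hφ : Monotone φ) :
    ∫ x in Icc (-c) c, φ (u x) ≤ ∫ x in Icc (-c) c, φ (v x) := by
  obtain ⟨C, hC⟩ := isCompact_Icc.exists_bound_of_continuousOn hu
  obtain ⟨D, hD⟩ := isCompact_Icc.exists_bound_of_continuousOn hv
  -- A common lower bound of `u` and `v`: subtracting `φ m` and cutting at `0` makes `φ`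
  -- nonnegative, and on the relevant values changes it only by a constant.
  set m := min (-C) (-D)
  set ψ : ℝ → ℝ := fun y => max (φ y - φ m) 0 with hψ
  have hψm : Monotone ψ := fun x y hxy =>
    max_le_max_right _ (sub_le_sub_right (hφ hxy) _)
  have hψ0 : ∀ y, 0 ≤ ψ y := fun y => le_max_right _ _
  have hle := lintegral_comp_le hu hv huv heven hanti hψm hψ0
  have hui := integrableOn_comp_of_monotone hu hψm
  have hvi := integrableOn_comp_of_monotone hv hψm
  rw [← ofReal_integral_eq_lintegral_ofReal hui (.of_forall fun x => hψ0 _),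
    ← ofReal_integral_eq_lintegral_ofReal hvi (.of_forall fun x => hψ0 _),
    ENNReal.ofReal_le_ofReal_iff (integral_nonneg fun x => hψ0 _)] at hle
  have e : ∀ w : ℝ → ℝ, ContinuousOn w (Icc (-c) c) → (∀ x ∈ Icc (-c) c, m ≤ w x) →
      ∫ x in Icc (-c) c, ψ (w x) =
        (∫ x in Icc (-c) c, φ (w x)) - ∫ x in Icc (-c) c, φ m := by
    intro w hw hwm
    rw [← integral_sub (integrableOn_comp_of_monotone hw hφ) (integrable_const _)]
    refine setIntegral_congr_fun measurableSet_Icc fun x hx => ?_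
    exact max_eq_left (sub_nonneg.2 (hφ (hwm x hx)))
  rw [e u hu fun x hx => (min_le_left _ _).trans (abs_le.1 (hC x hx)).1,
    e v hv fun x hx => (min_le_right _ _).trans (abs_le.1 (hD x hx)).1] at hle
  linarith

theorem eLpNorm_le_of_comparison (hu : ContinuousOn u (Icc (-c) c))
    (hv : ContinuousOn v (Icc (-c) c))
    (huv : ∀ x ∈ Icc (-c) c, ∀ y ∈ Icc (-c) c, x ≤ y → min (u x) (u y) ≤ v ((y - x) / 2))
    (heven : ∀ x ∈ Icc (-c) c, v (-x) = v x) (hanti : AntitoneOn v (Icc 0 c))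
    (hu0 : ∀ x ∈ Icc (-c) c, 0 ≤ u x) (hv0 : ∀ x ∈ Icc (-c) c, 0 ≤ v x)
    {p : ENNReal} (hp : p ≠ 0) :
    eLpNorm u p (volume.restrict (Icc (-c) c)) ≤ eLpNorm v p (volume.restrict (Icc (-c) c)) := by
  by_cases hpt : p = ⊤
  · subst hpt
    rw [eLpNorm_exponent_top, eLpNorm_exponent_top]
    have e : ∀ w : ℝ → ℝ, (∀ x ∈ Icc (-c) c, 0 ≤ w x) →
        eLpNormEssSup w (volume.restrict (Icc (-c) c)) =
          essSup (fun x => ENNReal.ofReal (w x)) (volume.restrict (Icc (-c) c)) := by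
      intro w hw
      refine essSup_congr_ae ((ae_restrict_iff' measurableSet_Icc).2 (.of_forall fun x hx => ?_))
      exact Real.enorm_of_nonneg (hw x hx)
    rw [e u hu0, e v hv0, essSup_eq_sInf, essSup_eq_sInf]
    refine sInf_le_sInf fun s hs => ?_
    simp only [mem_ofPred_eq, Measure.restrict_apply' (measurableSet_Icc (a := -c) (b := c))]
      at hs ⊢
    rw [inter_comm] at hs ⊢
    exact le_antisymm (hs ▸ volume_superlevel_comp_le huv heven hanti
      (fun _ _ h => ENNReal.ofReal_le_ofReal h) s) zero_le
  · have hp0 : 0 < p.toReal := ENNReal.toReal_pos hp hpt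
    rw [eLpNorm_eq_lintegral_rpow_enorm_toReal hp hpt,
      eLpNorm_eq_lintegral_rpow_enorm_toReal hp hpt]
    refine ENNReal.rpow_le_rpow ?_ (by positivity)
    have e : ∀ w : ℝ → ℝ, (∀ x ∈ Icc (-c) c, 0 ≤ w x) →
        ∫⁻ x in Icc (-c) c, ‖w x‖ₑ ^ p.toReal =
          ∫⁻ x in Icc (-c) c, ENNReal.ofReal ((max (w x) 0) ^ p.toReal) := by
      intro w hw
      refine setLIntegral_congr_fun measurableSet_Icc fun x hx => ?_
      rw [Real.enorm_of_nonneg (hw x hx), max_eq_left (hw x hx),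
        ENNReal.ofReal_rpow_of_nonneg (hw x hx) hp0.le]
    rw [e u hu0, e v hv0]
    exact lintegral_comp_le hu hv huv heven hanti
      (φ := fun y => (max y 0) ^ p.toReal)
      (fun x y hxy => Real.rpow_le_rpow (le_max_right _ _) (max_le_max_right _ hxy) hp0.le)
      (fun y => Real.rpow_nonneg (le_max_right _ _) _)

/-- If `u` and `v` have the same integrals after composition with a strictly increasing function,
then their maxima agree. -/
theorem exists_le_of_integral_comp_eq (hc : 0 < c) (hu : ContinuousOn u (Icc (-c) c))
    (hv : ContinuousOn v (Icc (-c) c))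
    (huv : ∀ x ∈ Icc (-c) c, ∀ y ∈ Icc (-c) c, x ≤ y → min (u x) (u y) ≤ v ((y - x) / 2))
    (heven : ∀ x ∈ Icc (-c) c, v (-x) = v x) (hanti : AntitoneOn v (Icc 0 c))
    {φ : ℝ → ℝ} (hφ : StrictMono φ)
    (h : ∫ x in Icc (-c) c, φ (u x) = ∫ x in Icc (-c) c, φ (v x)) :
    ∃ x ∈ Icc (-c) c, v 0 ≤ u x := by
  obtain ⟨x, hx, hmax⟩ := isCompact_Icc.exists_isMaxOn (nonempty_Icc.2 (by linarith)) hu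
  refine ⟨x, hx, ?_⟩
  -- Truncating at the maximum of `u` leaves the `u`-integral unchanged. The comparison for the
  -- truncated function then shows that the `v`-integral loses nothing either, so `v` exceeds `u x`
  -- only on a null set.
  have hψ : Monotone fun y => φ (min y (u x)) :=
    fun y z hyz => hφ.monotone (min_le_min_right _ hyz)
  have h1 := integral_comp_le hu hv huv heven hanti hψ
  have h2 : ∫ y in Icc (-c) c, φ (min (u y) (u x)) = ∫ y in Icc (-c) c, φ (u y) :=
    setIntegral_congr_fun measurableSet_Icc fun y hy =>
      congrArg φ (min_eq_left (hmax hy))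
  have hi1 := integrableOn_comp_of_monotone hv hφ.monotone
  have hi2 := integrableOn_comp_of_monotone hv hψ
  have hnn : ∀ y, 0 ≤ φ (v y) - φ (min (v y) (u x)) :=
    fun y => sub_nonneg.2 (hφ.monotone (min_le_left _ _))
  have hz : ∫ y in Icc (-c) c, (φ (v y) - φ (min (v y) (u x))) = 0 := by
    refine le_antisymm ?_ (integral_nonneg hnn)
    rw [integral_sub hi1 hi2]
    linarith
  rw [integral_eq_zero_iff_of_nonneg hnn (hi1.sub hi2)] at hz
  by_contra hlt
  have hnhds : Icc (-c) c ∈ nhds (0 : ℝ) := Icc_mem_nhds (by linarith) hc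
  have hev : ∀ᶠ y in nhds (0 : ℝ), y ∈ Icc (-c) c ∧ u x < v y :=
    Filter.Eventually.and hnhds ((hv.continuousAt hnhds).eventually (lt_mem_nhds (not_le.1 hlt)))
  refine hev.volume_pos_of_nhds_real.ne' ?_
  rw [Filter.EventuallyEq, ae_restrict_iff' measurableSet_Icc] at hz
  refine measure_mono_null (fun y hy => ?_) (ae_iff.1 hz)
  intro hcon
  have := hcon hy.1
  simp only [Pi.zero_apply, min_eq_right hy.2.le] at this
  linarith [hφ hy.2]

end comparison

/-! ### Symmetry of the kernel and the main theorem -/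

theorem trapezoid_self_neg (a x y : ℝ) : trapezoid a (-x) (-x) (-y) = trapezoid a x x y := by
  unfold trapezoid
  rw [min_comm ((a - -x) * (a + -y))]
  congr 1
  · congr 1
    · ring
    · congr 1 <;> ring
  · ring

theorem theorem1p2 (α : ℝ) (hα : 0 < α)
    (f : ℝ → ℝ) (hf : IntegrableOn f (Icc (-π) π) volume)
    (hf0 : ∀ᵐ x ∂(volume.restrict (Icc (-π) π)), 0 ≤ f x)
    (u v : ℝ → ℝ)
    (hu : IsRobinSolution α (fun x => (f x : EReal)) u)
    (hv : IsRobinSolution α (symmDecreasingRearrangement (Icc (-π) π) f) v) :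
    (∀ φ : ℝ → ℝ, ConvexOn ℝ univ φ → Monotone φ →
      ∫ x in (-π)..π, φ (u x) ≤ ∫ x in (-π)..π, φ (v x)) ∧
    (∀ φ : ℝ → ℝ, ConvexOn ℝ univ φ → StrictMono φ →
      (∫ x in (-π)..π, φ (u x) = ∫ x in (-π)..π, φ (v x) ↔
        ∀ᵐ x ∂(volume.restrict (Icc (-π) π)),
          (f x : EReal) = symmDecreasingRearrangement (Icc (-π) π) f x)) ∧
    (∀ p : ENNReal, 1 ≤ p →
      eLpNorm u p (volume.restrict (Icc (-π) π)) ≤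
        eLpNorm v p (volume.restrict (Icc (-π) π))) := by
  obtain ⟨g, hgm, hg0, hgeven, hGg, hfg⟩ := exists_real_symmDecreasingRearrangement pi_pos hf hf0
  -- a measurable and everywhere nonnegative version of `f`
  have hfm : AEMeasurable f (volume.restrict (Icc (-π) π)) := hf.aestronglyMeasurable.aemeasurable
  set F : ℝ → ℝ := fun x => max (hfm.mk f x) 0 with hF
  have hFm : Measurable F := hfm.measurable_mk.max measurable_const
  have hF0 : ∀ x, 0 ≤ F x := fun x => le_max_right _ _
  have hfF : f =ᵐ[volume.restrict (Icc (-π) π)] F := by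
    filter_upwards [hfm.ae_eq_mk, hf0] with x h1 h2
    simp only [hF, ← h1, max_eq_left h2]
  have hFg : ∀ t, 0 < t → (Icc (-π) π ∩ {x | t < g x} : Set ℝ) =ᵐ[volume]
      Icc (-((volume (Icc (-π) π ∩ {x | t < F x})).toReal / 2))
        ((volume (Icc (-π) π ∩ {x | t < F x})).toReal / 2) := by
    intro t ht
    have : volume (Icc (-π) π ∩ {x | t < F x}) = volume (Icc (-π) π ∩ {x | t < f x}) := by
      rw [inter_comm, inter_comm _ {x | t < f x}, ← Measure.restrict_apply' measurableSet_Icc,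
        ← Measure.restrict_apply' measurableSet_Icc]
      refine measure_congr ?_
      filter_upwards [hfF] with x hx
      exact congrArg (t < ·) hx.symm
    rw [this]
    exact hfg t ht.le
  have hGF : ∀ᵐ x ∂volume.restrict (Icc (-π) π), ((f x : ℝ) : EReal) = (F x : EReal) := by
    filter_upwards [hfF] with x hx
    rw [hx]
  have hα' : 0 < 1 / α := by positivity
  have hπ := pi_pos
  set a := π + 1 / α with ha
  have hca : π < a := by linarith
  have hgi := hv.integrableOn hGg
  have hFi := hu.integrableOn hGF
  have hXa : Icc (-π) π ⊆ Icc (-a) a := Icc_subset_Icc (by linarith) hca.le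
  have hnonneg : ∀ k : ℝ → ℝ, (∀ x, 0 ≤ k x) → ∀ x ∈ Icc (-π) π,
      0 ≤ ∫ y in Icc (-π) π, k y * trapezoid a x x y := fun k hk x hx =>
    setIntegral_nonneg measurableSet_Icc fun y hy =>
      mul_nonneg (hk y) (trapezoid_nonneg (by linarith [hx.1]) (by linarith [hx.2]) (hXa hy))
  have hu0 : ∀ x ∈ Icc (-π) π, 0 ≤ u x := fun x hx => by
    rw [hu.eq_integral_mul_trapezoid hα hGF hx]; exact hnonneg F hF0 x hx
  have hv0 : ∀ x ∈ Icc (-π) π, 0 ≤ v x := fun x hx => by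
    rw [hv.eq_integral_mul_trapezoid hα hGg hx]; exact hnonneg g hg0 x hx
  have heven : ∀ x ∈ Icc (-π) π, v (-x) = v x := by
    intro x hx
    rw [hv.eq_integral_mul_trapezoid hα hGg hx,
      hv.eq_integral_mul_trapezoid hα hGg (x := -x) ⟨by linarith [hx.2], by linarith [hx.1]⟩,
      integral_Icc_eq_integral_Ioc, ← intervalIntegral.integral_of_le (by linarith),
      integral_Icc_eq_integral_Ioc, ← intervalIntegral.integral_of_le (by linarith)]
    have := intervalIntegral.integral_comp_neg (a := -π) (b := π)
      (fun y => g y * trapezoid a (-x) (-x) y)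
    rw [neg_neg] at this
    rw [← this]
    simp only [hgeven, trapezoid_self_neg, ← ha]
  -- For poles `±h` the two weights are equal, so by evenness the mean is `v h`. In this form
  -- monotonicity is visible: the kernel `min (a - h) (a - |y|) / 2` decreases in `h`.
  have hvh : ∀ h ∈ Icc 0 π, v h = ∫ y in Icc (-π) π, g y * trapezoid a (-h) h y := by
    intro h hh
    rw [hv.integral_mul_trapezoid hα hGg (by linarith [hh.2]) (by linarith [hh.1]) hh.2,
      heven h ⟨by linarith [hh.1], hh.2⟩]
    have : 2 * (π + 1 / α) + -h - h ≠ 0 := by linarith [hh.2]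
    rw [eq_div_iff this]
    ring
  have hanti : AntitoneOn v (Icc 0 π) := by
    intro s hs t ht hst
    rw [hvh s hs, hvh t ht]
    refine setIntegral_mono_on
      (hgi.mul_continuousOn (continuous_trapezoid a _ _).continuousOn isCompact_Icc)
      (hgi.mul_continuousOn (continuous_trapezoid a _ _).continuousOn isCompact_Icc)
      measurableSet_Icc fun y _ => mul_le_mul_of_nonneg_left ?_ (hg0 y)
    rw [trapezoid_symm_eq (by linarith [ht.2]), trapezoid_symm_eq (by linarith [hs.2])]
    have := min_le_min_right (a - |y|) (sub_le_sub_left hst a)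
    linarith
  have huv : ∀ x ∈ Icc (-π) π, ∀ y ∈ Icc (-π) π, x ≤ y →
      min (u x) (u y) ≤ v ((y - x) / 2) := by
    intro x hx y hy hxy
    have hxa : -a < x := by linarith [hx.1]
    have hya : y < a := by linarith [hy.2]
    have h1 := integral_mul_trapezoid_le hπ.le hca hFm hF0 hgi hgm hg0 hFg hxa hxy hya
    rw [← hvh _ ⟨by linarith, by linarith [hx.1, hy.2]⟩,
      hu.integral_mul_trapezoid hα hGF hx.1 hxy hy.2, ← ha] at h1
    refine le_trans ?_ h1
    rw [le_div_iff₀ (by linarith)]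
    have e1 := mul_le_mul_of_nonneg_left (min_le_left (u x) (u y)) (by linarith : 0 ≤ a - y)
    have e2 := mul_le_mul_of_nonneg_left (min_le_right (u x) (u y)) (by linarith : 0 ≤ a + x)
    linarith
  have huc := hu.contDiffOn.continuousOn
  have hvc := hv.contDiffOn.continuousOn
  have hint : ∀ w : ℝ → ℝ, ∫ x in (-π)..π, w x = ∫ x in Icc (-π) π, w x := fun w => by
    rw [integral_Icc_eq_integral_Ioc, intervalIntegral.integral_of_le (by linarith)]
  refine ⟨fun φ _ hφ => ?_, fun φ _ hφ => ?_, fun p hp => ?_⟩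
  · rw [hint, hint]
    exact integral_comp_le huc hvc huv heven hanti hφ
  · rw [hint, hint]
    constructor
    · intro h
      obtain ⟨x, hx, hle⟩ := exists_le_of_integral_comp_eq hπ huc hvc huv heven hanti hφ h
      -- Through Green's formula, `v 0 ≤ u x` is the reverse Hardy-Littlewood inequality for the
      -- poles `0` and `x`.
      rw [hv.eq_integral_mul_trapezoid hα hGg (x := 0) ⟨by linarith, hπ.le⟩,
        hu.eq_integral_mul_trapezoid hα hGF hx] at hle
      have hae := ae_eq_of_integral_mul_trapezoid_le hπ.le hca hFm hFi hF0 hgi hgm hg0 hFg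
        (by linarith [hx.1]) (by linarith [hx.2]) hle
      filter_upwards [hae, hfF, hGg] with y h1 h2 h3
      rw [h3, h2, h1]
    · intro h
      refine setIntegral_congr_fun measurableSet_Icc fun x hx => ?_
      have : u x = v x := by
        rw [hv.eq_integral_mul_trapezoid hα hGg hx, hu.eq_integral_mul_trapezoid hα hGF hx]
        refine integral_congr_ae ?_
        filter_upwards [h, hfF, hGg] with y h1 h2 h3
        rw [h3, EReal.coe_eq_coe_iff] at h1
        rw [← h2, h1]
      simp only [this]
  · exact eLpNorm_le_of_comparison huc hvc huv heven hanti hu0 hv0 (zero_lt_one.trans_le hp).ne'
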